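/- Let $E$ and $F$ be complex Banach spaces, let $U\subseteq E$ be open, and let $v\colon U\to(0,\infty)$ be continuous. Let $\mathcal H_v^\infty(U,F)$ be the space of holomorphic maps $f\colon U\to F$ with $\|f\|_v:=\sup_{x\in U}v(x)\|f(x)\|<\infty$ (the supremum over the empty set being $0$), and put $(vf)(U):=\{v(x)f(x):x\in U\}$. A set $K\subseteq F$ is a Grothendieck set if $T(K)$ is relatively weakly compact in $c_0$ for every bounded linear operator $T\colon F\to c_0$. Define $\mathcal H_{v\mathcal O}^\infty(U,F)$ (respectively $\mathcal H_{v\mathcal K_w}^\infty(U,F)$) as the set of all $f\in\mathcal H_v^\infty(U,F)$ for which $(vf)(U)$ is a Grothendieck set (respectively relatively weakly compact) in $F$. For a complex Banach space $G$, let $\mathcal S(F,G)$ be the set of bounded linear operators $A\colon F\to G$ such that the image $A(B_F)$ of the closed unit ball is separable. The left-hand quotient $\mathcal S^{-1}\circ\mathcal H_{v\mathcal K_w}^\infty(U,F)$ is the set of all $f\in\mathcal H_v^\infty(U,F)$ such that $A\circ f\in\mathcal H_{v\mathcal K_w}^\infty(U,G)$ for every complex Banach space $G$ and every $A\in\mathcal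 S(F,G)$, with $$\|f\|_{\mathcal S^{-1}\circ\mathcal H_{v\mathcal K_w}^\infty}:=\sup\{\|A\circ f\|_v : G \text{ a complex Banach space},\ A\in\mathcal S(F,G),\ \|A\|\le 1\}.$$ Then $$\mathcal H_{v\mathcal O}^\infty(U,F)=\mathcal S^{-1}\circ\mathcal H_{v\mathcal K_w}^\infty(U,F),$$ and for every $f$ in this set the supremum above is finite and $$\|f\|_v=\|f\|_{\mathcal S^{-1}\circ\mathcal H_{v\mathcal K_w}^\infty}.$$ -/

import Mathlib

open TopologicalSpace
open scoped ZeroAtInfty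

universe u v w

namespace WeightedHolomorphic

noncomputable section

section Sets

variable {F : Type v} [NormedAddCommGroup F] [NormedSpace ℂ F]

/-- `K` is relatively weakly compact: its closure in the weak topology is compact. -/
def IsRelWeaklyCompact (K : Set F) : Prop :=
  IsCompact (closure (toWeakSpace ℂ F '' K))

/-- `K` is a Grothendieck set: every bounded operator from `F` to the complex space `c₀`
maps `K` onto a relatively weakly compact set. -/
def IsGrothendieckSet (K : Set F) : Prop :=
  ∀ T : F →L[ℂ] C₀(ℕ, ℂ), IsRelWeaklyCompact (T '' K)

/-- `𝒮(F, G)`: the bounded operators that map the closed unit ball onto a separable set. -/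
def separableOperators (F : Type v) [NormedAddCommGroup F] [NormedSpace ℂ F]
    (G : Type w) [NormedAddCommGroup G] [NormedSpace ℂ G] : Set (F →L[ℂ] G) :=
  {A | IsSeparable (A '' Metric.closedBall 0 1)}

end Sets

section Mappings

variable {E : Type u} [NormedAddCommGroup E] [NormedSpace ℂ E] {U : Opens E}
variable {F : Type v} [NormedAddCommGroup F] [NormedSpace ℂ F]

/-- A mapping `f : U → F` on an open set is holomorphic: it is complex Fréchet differentiable at
every point of `U`. The values of the extension outside the open set `U` play no role. -/
def IsHolomorphic (f : U → F) : Prop :=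
  DifferentiableOn ℂ (Function.extend Subtype.val f 0) (U : Set E)

/-- The weighted supremum norm `‖f‖_v = sup {v(x) ‖f(x)‖ : x ∈ U}`. -/
def weightedNorm (v : U → ℝ) (f : U → F) : ℝ :=
  ⨆ x : U, v x * ‖f x‖

/-- The space `H_v^∞(U, F)` of weighted holomorphic mappings. -/
def weightedHol (v : U → ℝ) (F : Type v) [NormedAddCommGroup F] [NormedSpace ℂ F] :
    Set (U → F) :=
  {f | IsHolomorphic f ∧ BddAbove (Set.range fun x : U => v x * ‖f x‖)}

/-- The weighted range `(vf)(U)`. -/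
def weightedRange (v : U → ℝ) (f : U → F) : Set F :=
  Set.range fun x : U => (v x : ℂ) • f x

/-- The Grothendieck weighted holomorphic mappings from `U` to `F`. -/
def grothendieckHol (v : U → ℝ) (F : Type v) [NormedAddCommGroup F] [NormedSpace ℂ F] :
    Set (U → F) :=
  {f | f ∈ weightedHol v F ∧ IsGrothendieckSet (weightedRange v f)}

/-- The weakly compact weighted holomorphic mappings from `U` to `F`. -/
def weaklyCompactHol (v : U → ℝ) (F : Type v) [NormedAddCommGroup F] [NormedSpace ℂ F] :
    Set (U → F) :=
  {f | f ∈ weightedHol v F ∧ IsRelWeaklyCompact (weightedRange v f)}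

/-- The component on `(U, F)` of the left-hand quotient `𝒜⁻¹ ∘ ℐ`: the weighted holomorphic `f`
such that `A ∘ f ∈ ℐ(U, G)` for all complex Banach spaces `G` and all `A ∈ 𝒜(F, G)`.
Only the components `𝒜(F, ·)` and `ℐ(U, ·)` enter. -/
def leftQuotient (v : U → ℝ)
    (𝒜 : ∀ (G : Type w) [NormedAddCommGroup G] [NormedSpace ℂ G], Set (F →L[ℂ] G))
    (ℐ : ∀ (G : Type w) [NormedAddCommGroup G] [NormedSpace ℂ G], Set (U → G)) :
    Set (U → F) :=
  {f | f ∈ weightedHol v F ∧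
    ∀ (G : Type w) [NormedAddCommGroup G] [NormedSpace ℂ G] [CompleteSpace G],
      ∀ A ∈ 𝒜 G, (fun x => A (f x)) ∈ ℐ G}

/-- The numbers `‖A ∘ f‖_ℐ`, where `A ∈ 𝒜(F, G)` with `‖A‖_𝒜 ≤ 1` and `G` ranges over all complex
Banach spaces. -/
def leftQuotientValues
    (𝒜 : ∀ (G : Type w) [NormedAddCommGroup G] [NormedSpace ℂ G], Set (F →L[ℂ] G))
    (norm𝒜 : ∀ (G : Type w) [NormedAddCommGroup G] [NormedSpace ℂ G], (F →L[ℂ] G) → ℝ)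
    (normℐ : ∀ (G : Type w) [NormedAddCommGroup G] [NormedSpace ℂ G], (U → G) → ℝ)
    (f : U → F) : Set ℝ :=
  {r | ∃ (G : Type w) (_ : NormedAddCommGroup G) (_ : NormedSpace ℂ G) (_ : CompleteSpace G),
    ∃ A ∈ 𝒜 G, norm𝒜 G A ≤ 1 ∧ r = normℐ G (fun x => A (f x))}

/-- The component on `(U, F)` of `𝒮⁻¹ ∘ H_{v𝒦_w}^∞`. -/
def separableQuotient (v : U → ℝ) (F : Type v) [NormedAddCommGroup F] [NormedSpace ℂ F] :
    Set (U → F) :=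
  leftQuotient.{u, v, w} v (fun G => separableOperators F G) (fun G => weaklyCompactHol v G)

/-- The set whose supremum is the norm of `f` in `𝒮⁻¹ ∘ H_{v𝒦_w}^∞`; here `𝒮` carries the operator
norm and `H_{v𝒦_w}^∞` carries `‖·‖_v`. -/
def separableQuotientValues (v : U → ℝ) (f : U → F) : Set ℝ :=
  leftQuotientValues.{u, v, w} (fun G => separableOperators F G) (fun _ _ _ A => ‖A‖)
    (fun _ _ _ g => weightedNorm v g) f

/-- The norm of `f` in `𝒮⁻¹ ∘ H_{v𝒦_w}^∞`. -/
def separableQuotientNorm (v : U → ℝ) (f : U → F) : ℝ :=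
  sSup (separableQuotientValues.{u, v, w} v f)

end Mappings

end

end WeightedHolomorphic

/-!
The heart of the matter is that a bounded operator `A : F → G` with separable range maps every
bounded Grothendieck set `K` onto a relatively weakly compact set
(`IsGrothendieckSet.isRelWeaklyCompact_image`).

By Banach–Alaoglu it suffices to show that the weak-star closure of `A(K)` in the bidual of `G`
consists of (evaluations at) points of `G`. Let `φ` be in that closure. If `φ(lₙ) → 0` for every
bounded sequence of functionals `lₙ` on `G` with `lₙ ∘ A → 0` pointwise, then, because the range of
`A` is separable, for each `ε > 0` there is a finite set `s ⊆ G` such that `|φ(l)| ≤ ε ‖l‖` for all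
functionals `l` vanishing on `s`: otherwise one could choose normalized `lₙ` vanishing on the first
`n` terms of a dense sequence with `|φ(lₙ)| > ε`. Extending the restriction of `φ` to the
annihilator of `s` by Hahn–Banach shows that `φ` is within `ε` of the span of `s`, and since `G` is
complete, `φ` is a point of `G` (`mem_range_inclusionInDoubleDual_of_approx`). That `φ(lₙ) → 0`
comes from the Grothendieck property applied to the operator `y ↦ (lₙ (A y))ₙ` into `c₀`: the
coordinates of the relatively weakly compact image of `K` form a relatively compact subset of the
coordinatewise topology all of whose limit points are null sequences
(`IsGrothendieckSet.tendsto_of_mem_closure`).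

Conversely, `c₀` is separable, so every operator into `c₀` is one of the test operators of the
quotient. The equality of norms is attained along norming functionals, which have separable range.
-/

open Filter Topology Bornology NormedSpace

namespace WeightedHolomorphic

/-! ### The space `c₀` -/

/-- A bounded, pointwise null sequence of functionals is the coordinate sequence of a bounded
operator into `c₀`. -/
theorem exists_clm_zeroAtInfty {F : Type*} [NormedAddCommGroup F] [NormedSpace ℂ F]
    (l : ℕ → StrongDual ℂ F) (C : ℝ) (hC : ∀ n, ‖l n‖ ≤ C)
    (hl : ∀ y, Tendsto (fun n => l n y) atTop (𝓝 0)) :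
    ∃ T : F →L[ℂ] C₀(ℕ, ℂ), ∀ y n, T y n = l n y := by
  let L : F →ₗ[ℂ] C₀(ℕ, ℂ) :=
    { toFun := fun y =>
        { toFun := fun n => l n y
          continuous_toFun := continuous_of_discreteTopology
          zero_at_infty' := by
            rw [cocompact_eq_atTop]
            exact hl y }
      map_add' := fun x y => by ext n; simp
      map_smul' := fun c x => by ext n; simp }
  refine ⟨L.mkContinuous C fun y => ?_, fun y n => rfl⟩
  have hC0 : 0 ≤ C := (norm_nonneg _).trans (hC 0)
  rw [← ZeroAtInftyContinuousMap.norm_toBCF_eq_norm]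
  refine (BoundedContinuousFunction.norm_le (by positivity)).2 fun n => ?_
  exact (l n).le_of_opNorm_le (hC n) y

/-- Evaluation of elements of `c₀` at an index, as a functional. -/
theorem exists_dual_zeroAtInfty_eval (n : ℕ) :
    ∃ e : StrongDual ℂ C₀(ℕ, ℂ), ∀ c, e c = c n := by
  let L : C₀(ℕ, ℂ) →ₗ[ℂ] ℂ :=
    { toFun := fun c => c n
      map_add' := fun _ _ => rfl
      map_smul' := fun _ _ => rfl }
  refine ⟨L.mkContinuous 1 fun c => ?_, fun c => rfl⟩
  rw [one_mul, ← ZeroAtInftyContinuousMap.norm_toBCF_eq_norm]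
  exact c.toBCF.norm_coe_le_norm n

theorem separableSpace_zeroAtInfty : SeparableSpace C₀(ℕ, ℂ) := by
  let e : ℕ → C₀(ℕ, ℂ) := fun i =>
    { toFun := Pi.single i 1
      continuous_toFun := continuous_of_discreteTopology
      zero_at_infty' := by
        rw [cocompact_eq_atTop]
        refine tendsto_const_nhds.congr' ?_
        filter_upwards [eventually_gt_atTop i] with n hn
        rw [Pi.single_eq_of_ne hn.ne'] }
  have he : ∀ i n, e i n = if n = i then 1 else 0 := fun i n => Pi.single_apply i (1 : ℂ) n
  have hs : IsSeparable (Submodule.span ℂ (Set.range e) : Set C₀(ℕ, ℂ)) :=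
    (Set.countable_range e).isSeparable.span
  have hd : closure (Submodule.span ℂ (Set.range e) : Set C₀(ℕ, ℂ)) = Set.univ := by
    refine Set.eq_univ_of_forall fun g => Metric.mem_closure_iff.2 fun ε hε => ?_
    have hg : Tendsto g atTop (𝓝 0) := by
      have := g.zero_at_infty'
      rwa [cocompact_eq_atTop] at this
    obtain ⟨N, hN⟩ := Metric.tendsto_atTop.1 hg (ε / 2) (half_pos hε)
    refine ⟨∑ i ∈ Finset.range N, g i • e i, Submodule.sum_mem _ fun i _ =>
      Submodule.smul_mem _ _ (Submodule.subset_span ⟨i, rfl⟩), ?_⟩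
    refine lt_of_le_of_lt ?_ (half_lt_self hε)
    rw [← ZeroAtInftyContinuousMap.dist_toBCF_eq_dist]
    refine (BoundedContinuousFunction.dist_le (half_pos hε).le).2 fun n => ?_
    obtain ⟨δ, hδ⟩ := exists_dual_zeroAtInfty_eval n
    change dist (g n) ((∑ i ∈ Finset.range N, g i • e i) n) ≤ ε / 2
    have hsum : (∑ i ∈ Finset.range N, g i • e i) n = if n < N then g n else 0 := by
      rw [← hδ, map_sum]
      simp [hδ, he]
    rw [hsum]
    split_ifs with h
    · simpa using (half_pos hε).le
    · exact (hN n (not_lt.1 h)).le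
  have := hs.closure
  rw [hd] at this
  exact isSeparable_univ_iff.1 this

/-! ### Weak compactness of images of Grothendieck sets -/

section

variable {F : Type*} [NormedAddCommGroup F] [NormedSpace ℂ F]
  {G : Type*} [NormedAddCommGroup G] [NormedSpace ℂ G]

theorem mem_separableOperators_of_separableSpace [SeparableSpace G] (A : F →L[ℂ] G) :
    A ∈ separableOperators F G :=
  .of_separableSpace _

theorem isRelWeaklyCompact_image (A : F →L[ℂ] G) {K : Set F} (hK : IsRelWeaklyCompact K) :
    IsRelWeaklyCompact (A '' K) := by
  have hc : IsCompact (WeakSpace.map A '' closure (toWeakSpace ℂ F '' K)) :=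
    hK.image (WeakSpace.map A).continuous
  refine hc.closure_of_subset ?_
  rintro _ ⟨_, ⟨x, hx, rfl⟩, rfl⟩
  exact ⟨toWeakSpace ℂ F x, subset_closure ⟨x, hx, rfl⟩, rfl⟩

/-- An element of the bidual which, for each `ε > 0`, has norm at most `ε` on the annihilator of
some finite set is the evaluation at a point of the space. -/
theorem mem_range_inclusionInDoubleDual_of_approx [CompleteSpace G]
    (φ : StrongDual ℂ (StrongDual ℂ G))
    (h : ∀ ε > 0, ∃ s : Finset G, ∀ l : StrongDual ℂ G, (∀ y ∈ s, l y = 0) → ‖φ l‖ ≤ ε * ‖l‖) :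
    φ ∈ Set.range (inclusionInDoubleDual ℂ G) := by
  have hclosed : IsClosed (Set.range (inclusionInDoubleDual ℂ G)) :=
    (inclusionInDoubleDualLi (E := G) ℂ).isometry.isUniformInducing.isComplete_range.isClosed
  rw [← hclosed.closure_eq]
  refine (Metric.mem_closure_iff (α := StrongDual ℂ (StrongDual ℂ G))).2 fun ε hε => ?_
  obtain ⟨s, hs⟩ := h (ε / 2) (half_pos hε)
  let N : Submodule ℂ (StrongDual ℂ G) :=
    ⨅ y : s, ((inclusionInDoubleDual ℂ G y : StrongDual ℂ (StrongDual ℂ G)) :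
      StrongDual ℂ G →ₗ[ℂ] ℂ).ker
  have hN : ∀ l, l ∈ N ↔ ∀ y ∈ s, l y = 0 := fun l => by
    simp [N, Submodule.mem_iInf, LinearMap.mem_ker]
  -- `ψ` is a small extension of the restriction of `φ` to the annihilator of `s`
  obtain ⟨ψ, hψ, hψn⟩ := exists_extension_norm_eq N (φ.comp N.subtypeL)
  have hψ2 : ‖ψ‖ ≤ ε / 2 := by
    rw [hψn]
    exact ContinuousLinearMap.opNorm_le_bound _ (half_pos hε).le
      fun l => hs l ((hN _).1 l.2)
  have hspan := mem_span_of_iInf_ker_le_ker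
    (L := fun y : s => ((inclusionInDoubleDual ℂ G y : StrongDual ℂ (StrongDual ℂ G)) :
      StrongDual ℂ G →ₗ[ℂ] ℂ))
    (K := ((φ - ψ : StrongDual ℂ (StrongDual ℂ G)) : StrongDual ℂ G →ₗ[ℂ] ℂ))
    (fun l hl => by
      have := hψ ⟨l, hl⟩
      simp only [LinearMap.mem_ker]
      simpa [sub_eq_zero] using this.symm)
  obtain ⟨c, hc⟩ := (Submodule.mem_span_range_iff_exists_fun ℂ).1 hspan
  refine ⟨φ - ψ, ⟨∑ y, c y • (y : G), ?_⟩, ?_⟩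
  · ext l
    have := LinearMap.congr_fun hc l
    simpa using this
  · refine (dist_eq_norm (E := StrongDual ℂ (StrongDual ℂ G)) φ (φ - ψ)).trans_lt ?_
    have : φ - (φ - ψ) = ψ := by ext; simp
    exact (congrArg norm this).trans_lt (hψ2.trans_lt (half_lt_self hε))

/-- Elements of the weak-star closure of the image of a Grothendieck set behave like evaluations
along bounded sequences of functionals that are null on the range of the operator. -/
theorem IsGrothendieckSet.tendsto_of_mem_closure {K : Set F} (hK : IsGrothendieckSet K)
    (A : F →L[ℂ] G) (l : ℕ → StrongDual ℂ G) (hl : ∀ n, ‖l n‖ ≤ 1)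
    (hlA : ∀ y, Tendsto (fun n => l n (A y)) atTop (𝓝 0))
    (φ : WeakDual ℂ (StrongDual ℂ G))
    (hφ : φ ∈ closure (inclusionInDoubleDualWeak ℂ G '' (toWeakSpace ℂ G '' (A '' K)))) :
    Tendsto (fun n => φ (l n)) atTop (𝓝 0) := by
  obtain ⟨T, hT⟩ := exists_clm_zeroAtInfty (fun n => (l n).comp A) ‖A‖
    (fun n => ((l n).opNorm_comp_le A).trans
      (mul_le_of_le_one_left (norm_nonneg _) (hl n))) hlA
  choose e he using exists_dual_zeroAtInfty_eval
  let Φ : WeakDual ℂ (StrongDual ℂ G) → ℕ → ℂ := fun χ n => χ (l n)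
  let Ψ : WeakSpace ℂ C₀(ℕ, ℂ) → ℕ → ℂ := fun c n => e n ((toWeakSpace ℂ _).symm c)
  have hΦ : Continuous Φ := continuous_pi fun n => WeakDual.eval_continuous (l n)
  have hΨ : Continuous Ψ :=
    continuous_pi fun n => WeakBilin.eval_continuous (topDualPairing ℂ C₀(ℕ, ℂ)).flip (e n)
  have hclosed : IsClosed (Ψ '' closure (toWeakSpace ℂ _ '' (T '' K))) :=
    ((hK T).image hΨ).isClosed
  have hsub : inclusionInDoubleDualWeak ℂ G '' (toWeakSpace ℂ G '' (A '' K)) ⊆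
      Φ ⁻¹' (Ψ '' closure (toWeakSpace ℂ _ '' (T '' K))) := by
    rintro _ ⟨_, ⟨_, ⟨x, hx, rfl⟩, rfl⟩, rfl⟩
    refine ⟨toWeakSpace ℂ _ (T x), subset_closure ⟨_, ⟨x, hx, rfl⟩, rfl⟩, ?_⟩
    funext n
    exact (he n (T x)).trans (hT x n)
  obtain ⟨c, -, hc⟩ := closure_minimal hsub (hclosed.preimage hΦ) hφ
  have h0 := ((toWeakSpace ℂ C₀(ℕ, ℂ)).symm c).zero_at_infty'
  rw [cocompact_eq_atTop] at h0
  refine h0.congr fun n => ?_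
  exact (he n _).symm.trans (congrFun hc n)

theorem IsGrothendieckSet.isRelWeaklyCompact_image [CompleteSpace G] {K : Set F}
    (hK : IsGrothendieckSet K) (hb : IsBounded K) (A : F →L[ℂ] G)
    (hA : A ∈ separableOperators F G) : IsRelWeaklyCompact (A '' K) := by
  refine isCompact_closure_of_isBounded ℂ G _ ?_ ?_
  · rw [Set.preimage_image_eq _ (toWeakSpace ℂ G).injective]
    exact A.lipschitz.isBounded_image hb
  intro φ hφ
  obtain ⟨x, hx⟩ := mem_range_inclusionInDoubleDual_of_approx (WeakDual.toStrongDual φ) (by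
    by_contra! hcon
    obtain ⟨ε, hε, hcon⟩ := hcon
    obtain ⟨t, ht, htA⟩ := hA
    have htne : t.Nonempty := by
      rw [← closure_nonempty_iff]
      exact ⟨A 0, htA ⟨0, by simp, rfl⟩⟩
    obtain ⟨d, rfl⟩ := ht.exists_eq_range htne
    classical
    have hex : ∀ n : ℕ, ∃ l : StrongDual ℂ G, ‖l‖ ≤ 1 ∧ (∀ i < n, l (d i) = 0) ∧ ε ≤ ‖φ l‖ := by
      intro n
      obtain ⟨l, hl0, hl⟩ := hcon ((Finset.range n).image d)
      have hlpos : 0 < ‖l‖ := by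
        refine norm_pos_iff.2 fun h => ?_
        simp [h] at hl
      refine ⟨((‖l‖⁻¹ : ℝ) : ℂ) • l, ?_, fun i hi => ?_, ?_⟩
      · rw [norm_smul]
        simp [hlpos.ne']
      · simp [hl0 (d i) (Finset.mem_image_of_mem _ (Finset.mem_range.2 hi))]
      · change ε * ‖l‖ < ‖φ l‖ at hl
        rw [map_smul, norm_smul, Complex.norm_real, norm_inv, norm_norm, inv_mul_eq_div,
          le_div_iff₀ hlpos]
        exact hl.le
    choose l hl1 hl0 hlε using hex
    have hball : ∀ z ∈ A '' Metric.closedBall 0 1, Tendsto (fun n => l n z) atTop (𝓝 0) := by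
      intro z hz
      refine Metric.tendsto_atTop.2 fun δ hδ => ?_
      obtain ⟨_, ⟨i, rfl⟩, hi⟩ := Metric.mem_closure_iff.1 (htA hz) δ hδ
      refine ⟨i + 1, fun n hn => ?_⟩
      rw [dist_zero_right]
      calc ‖l n z‖ = ‖l n (z - d i)‖ := by rw [map_sub, hl0 n i hn, sub_zero]
        _ ≤ 1 * ‖z - d i‖ := (l n).le_of_opNorm_le (hl1 n) _
        _ < δ := by rwa [one_mul, ← dist_eq_norm]
    have hlA : ∀ y, Tendsto (fun n => l n (A y)) atTop (𝓝 0) := by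
      intro y
      rcases eq_or_ne y 0 with rfl | hy
      · simp
      have hy' : (‖y‖ : ℂ) ≠ 0 := by exact_mod_cast norm_ne_zero_iff.2 hy
      have h := (hball (A ((‖y‖ : ℂ)⁻¹ • y)) ⟨_, by simp [norm_smul, hy], rfl⟩).const_mul (‖y‖ : ℂ)
      rw [mul_zero] at h
      refine h.congr fun n => ?_
      rw [map_smul, map_smul, smul_eq_mul, mul_inv_cancel_left₀ hy']
    have hlim := (hK.tendsto_of_mem_closure A l hl1 hlA φ hφ).norm
    rw [norm_zero] at hlim
    exact absurd (ge_of_tendsto' hlim hlε) (not_le.2 hε))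
  exact ⟨toWeakSpace ℂ G x, congrArg StrongDual.toWeakDual hx⟩

end

/-! ### Composition of weighted holomorphic mappings with operators -/

section

variable {E : Type*} [NormedAddCommGroup E] {U : Opens E}
  {F : Type*} [NormedAddCommGroup F]

theorem weightedNorm_nonneg {v : U → ℝ} (hv0 : ∀ x, 0 < v x) (f : U → F) :
    0 ≤ weightedNorm v f :=
  Real.iSup_nonneg fun x => mul_nonneg (hv0 x).le (norm_nonneg _)

variable [NormedSpace ℂ F] {G : Type*} [NormedAddCommGroup G] [NormedSpace ℂ G]

theorem mul_norm_clm_apply_le {v : U → ℝ} (hv0 : ∀ x, 0 < v x) (f : U → F) (A : F →L[ℂ] G)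
    (x : U) : v x * ‖A (f x)‖ ≤ ‖A‖ * (v x * ‖f x‖) := by
  rw [mul_left_comm]
  exact mul_le_mul_of_nonneg_left (A.le_opNorm _) (hv0 x).le

theorem weightedRange_clm_comp (v : U → ℝ) (f : U → F) (A : F →L[ℂ] G) :
    weightedRange v (fun x => A (f x)) = A '' weightedRange v f := by
  rw [weightedRange, weightedRange, ← Set.range_comp]
  congr 1
  funext x
  simp

variable [NormedSpace ℂ E]

theorem IsHolomorphic.clm_comp {f : U → F} (hf : IsHolomorphic f) (A : F →L[ℂ] G) :
    IsHolomorphic fun x => A (f x) := by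
  refine (A.differentiable.comp_differentiableOn hf).congr fun x hx => ?_
  lift x to U using hx
  rw [Subtype.val_injective.extend_apply, Function.comp_apply, Subtype.val_injective.extend_apply]

theorem clm_comp_mem_weightedHol {v : U → ℝ} (hv0 : ∀ x, 0 < v x) {f : U → F}
    (hf : f ∈ weightedHol v F) (A : F →L[ℂ] G) : (fun x => A (f x)) ∈ weightedHol v G := by
  obtain ⟨hol, M, hM⟩ := hf
  refine ⟨hol.clm_comp A, ‖A‖ * M, ?_⟩
  rintro _ ⟨x, rfl⟩
  exact (mul_norm_clm_apply_le hv0 f A x).trans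
    (mul_le_mul_of_nonneg_left (hM ⟨x, rfl⟩) (norm_nonneg A))

theorem isBounded_weightedRange {v : U → ℝ} (hv0 : ∀ x, 0 < v x) {f : U → F}
    (hf : f ∈ weightedHol v F) : IsBounded (weightedRange v f) := by
  obtain ⟨-, M, hM⟩ := hf
  refine isBounded_iff_forall_norm_le.2 ⟨M, ?_⟩
  rintro _ ⟨x, rfl⟩
  rw [norm_smul, Complex.norm_real, Real.norm_of_nonneg (hv0 x).le]
  exact hM ⟨x, rfl⟩

theorem weightedNorm_clm_comp_le {v : U → ℝ} (hv0 : ∀ x, 0 < v x) {f : U → F}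
    (hf : f ∈ weightedHol v F) (A : F →L[ℂ] G) (hA : ‖A‖ ≤ 1) :
    weightedNorm v (fun x => A (f x)) ≤ weightedNorm v f := by
  refine Real.iSup_le (fun x => ?_) (weightedNorm_nonneg hv0 f)
  exact (mul_norm_clm_apply_le hv0 f A x).trans
    ((mul_le_of_le_one_left (mul_nonneg (hv0 x).le (norm_nonneg _)) hA).trans
      (le_ciSup hf.2 x))

end

/-! ### The quotient and its norm -/

section

variable {E : Type u} [NormedAddCommGroup E] [NormedSpace ℂ E] {U : Opens E}
  {F : Type v} [NormedAddCommGroup F] [NormedSpace ℂ F]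

theorem grothendieckHol_eq_separableQuotient {v : U → ℝ} (hv0 : ∀ x, 0 < v x) :
    grothendieckHol v F = separableQuotient.{u, v, w} v F := by
  refine Set.Subset.antisymm ?_ ?_
  · rintro f ⟨hf, hK⟩
    refine ⟨hf, fun G _ _ _ A hA => ⟨clm_comp_mem_weightedHol hv0 hf A, ?_⟩⟩
    rw [weightedRange_clm_comp]
    exact hK.isRelWeaklyCompact_image (isBounded_weightedRange hv0 hf) A hA
  · rintro f ⟨hf, hq⟩
    refine ⟨hf, fun T => ?_⟩
    -- the codomain `c₀` has to be lifted to the universe of the test spaces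
    let e := LinearIsometryEquiv.ulift.{_, _, w} ℂ C₀(ℕ, ℂ)
    have := separableSpace_zeroAtInfty
    have : SeparableSpace (ULift.{w} C₀(ℕ, ℂ)) :=
      e.symm.surjective.denseRange.separableSpace e.symm.continuous
    let T' : F →L[ℂ] ULift.{w} C₀(ℕ, ℂ) := (e.symm : C₀(ℕ, ℂ) →L[ℂ] ULift.{w} C₀(ℕ, ℂ)).comp T
    have h := (hq _ T' (mem_separableOperators_of_separableSpace T')).2
    rw [weightedRange_clm_comp] at h
    have h' := WeightedHolomorphic.isRelWeaklyCompact_image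
      (e : ULift.{w} C₀(ℕ, ℂ) →L[ℂ] C₀(ℕ, ℂ)) h
    rwa [Set.image_image] at h'

theorem mem_upperBounds_separableQuotientValues {v : U → ℝ} (hv0 : ∀ x, 0 < v x) {f : U → F}
    (hf : f ∈ weightedHol v F) :
    weightedNorm v f ∈ upperBounds (separableQuotientValues.{u, v, w} v f) := by
  rintro _ ⟨G, _, _, _, A, -, hA, rfl⟩
  exact weightedNorm_clm_comp_le hv0 hf A hA

/-- Norming functionals, viewed as operators of rank one, recover the weighted norm. -/
theorem weightedNorm_eq_separableQuotientNorm {v : U → ℝ} (hv0 : ∀ x, 0 < v x) {f : U → F}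
    (hf : f ∈ weightedHol v F) :
    weightedNorm v f = separableQuotientNorm.{u, v, w} v f := by
  have hub := mem_upperBounds_separableQuotientValues.{u, v, w} hv0 hf
  let e := LinearIsometryEquiv.ulift.{_, _, w} ℂ ℂ
  have : SeparableSpace (ULift.{w} ℂ) :=
    e.symm.surjective.denseRange.separableSpace e.symm.continuous
  have hmem : ∀ l : StrongDual ℂ F, ‖l‖ ≤ 1 →
      weightedNorm v (fun x => l (f x)) ≤ separableQuotientNorm.{u, v, w} v f := by
    intro l hl
    let A : F →L[ℂ] ULift.{w} ℂ := (e.symm : ℂ →L[ℂ] ULift.{w} ℂ).comp l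
    refine le_csSup ⟨_, hub⟩ ⟨ULift.{w} ℂ, inferInstance, inferInstance, inferInstance, A,
      mem_separableOperators_of_separableSpace A, ?_, rfl⟩
    exact A.opNorm_le_bound zero_le_one fun y => l.le_of_opNorm_le hl y
  refine le_antisymm ?_ ?_
  · refine Real.iSup_le (fun x => ?_) ?_
    · obtain ⟨l, hl, hlx⟩ := exists_dual_vector'' ℂ (f x)
      refine le_trans ?_ (hmem l hl)
      have hle : v x * ‖l (f x)‖ ≤ weightedNorm v fun x => l (f x) :=
        le_ciSup (clm_comp_mem_weightedHol hv0 hf l).2 x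
      rwa [hlx, RCLike.norm_ofReal, abs_norm] at hle
    · exact (weightedNorm_nonneg hv0 _).trans (hmem 0 (by simp))
  · exact Real.sSup_le hub (weightedNorm_nonneg hv0 f)

end

end WeightedHolomorphic

theorem mainTheorem1
    {E : Type u} [NormedAddCommGroup E] [NormedSpace ℂ E] [CompleteSpace E]
    {F : Type v} [NormedAddCommGroup F] [NormedSpace ℂ F] [CompleteSpace F]
    (U : TopologicalSpace.Opens E) (v : U → ℝ) (hv : Continuous v) (hv0 : ∀ x, 0 < v x) :
    WeightedHolomorphic.grothendieckHol v F =
        WeightedHolomorphic.separableQuotient.{u, v, w} v F ∧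
      ∀ f ∈ WeightedHolomorphic.grothendieckHol v F,
        BddAbove (WeightedHolomorphic.separableQuotientValues.{u, v, w} v f) ∧
          WeightedHolomorphic.weightedNorm v f =
            WeightedHolomorphic.separableQuotientNorm.{u, v, w} v f := by
  exact ⟨WeightedHolomorphic.grothendieckHol_eq_separableQuotient hv0, fun f hf =>
    ⟨⟨_, WeightedHolomorphic.mem_upperBounds_separableQuotientValues hv0 hf.1⟩,
      WeightedHolomorphic.weightedNorm_eq_separableQuotientNorm hv0 hf.1⟩⟩
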